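/- A vocabulary is a set of relation symbols with prescribed arities. All structures $\mathfrak A$ are finite with nonempty domain $A$. A team $X$ with (finite) domain $D$ is a set of assignments $s\colon D\to A$. Write $s(a/x)$ for the assignment with domain $D\cup\{x\}$ that maps $x$ to $a$ and agrees with $s$ on $D\setminus\{x\}$. For a set $\mathcal C$ of kinds of atoms, the formulas of $\mathrm{FO}(\mathcal C)$ are built from the literals $x=y$, $x\neq y$, $R(\vec x)$, $\neg R(\vec x)$ and the atoms in $\mathcal C$ by $\wedge,\vee,\exists x,\forall x$. The satisfaction relation $\mathfrak A\models_X\varphi$ (lax team semantics) is defined for teams $X$ whose domain contains the free variables of $\varphi$: a literal holds if every $s\in X$ satisfies it; $\wedge$ is conjunction; $\mathfrak A\models_X\psi\vee\theta$ iff $X=Y\cup Z$ for some $Y,Z\subseteq X$ with $\mathfrak A\models_Y\psi$ and $\mathfrak A\models_Z\theta$; $\mathfrak A\models_X\forall x\,\psi$ iff $\mathfrak A\models_{X[A/x]}\psi$, where $X[A/x]=\{s(a/x): s\in X, a\in A\}$; $\mathfrak A\models_X\exists x\,\psi$ iff $\mathfrak A\models_{X[F/x]}\psi$ for some $F\colon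 X\to\mathcal P(A)\setminus\{\emptyset\}$, where $X[F/x]=\{s(a/x): s\in X, a\in F(s)\}$. For tuples of variables, possibly of length $0$, the atoms are: * dependence: $\mathfrak A\models_X\mathrm{dep}(\vec x,\vec y)$ iff for all $s,s'\in X$, $s(\vec x)=s'(\vec x)$ implies $s(\vec y)=s'(\vec y)$; * inclusion ($|\vec x|=|\vec y|$): $\mathfrak A\models_X\vec x\subseteq\vec y$ iff for every $s\in X$ there is $s'\in X$ with $s(\vec x)=s'(\vec y)$; * conditional independence: $\mathfrak A\models_X\vec y\perp_{\vec x}\vec z$ iff for all $s,s'\in X$ with $s(\vec x)=s'(\vec x)$ there is $s''\in X$ with $s''(\vec x)=s(\vec x)$, $s''(\vec y)=s(\vec y)$ and $s''(\vec z)=s'(\vec z)$; * probabilistic inclusion ($|\vec x|=|\vec y|$): $\mathfrak A\models_X\vec x\le\vec y$ iff $|X_{\vec x=s(\vec x)}|\le|X_{\vec y=s(\vec x)}|$ for all assignments $s$ of values in $A$ to the variables of $\vec x$; * probabilistic conditional independence: $\mathfrak A\models_X\vec y\perp\!\!\!\perp_{\vec x}\vec z$ iff $|X_{\vec x\vec y=s(\vec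 x\vec y)}|\cdot|X_{\vec x\vec z=s(\vec x\vec z)}|=|X_{\vec x\vec y\vec z=s(\vec x\vec y\vec z)}|\cdot|X_{\vec x=s(\vec x)}|$ for all assignments $s$ of values in $A$ to the variables of $\vec x\vec y\vec z$. Here $X_{\vec u=\vec a}=\{t\in X: t(\vec u)=\vec a\}$; that is, the probabilistic atoms are evaluated on the multiteam $(X,1)$ in which every assignment has multiplicity $1$. A sentence is a formula without free variables, and $\mathfrak A\models\varphi$ means $\mathfrak A\models_{\{\emptyset\}}\varphi$, where $\{\emptyset\}$ is the team that contains only the empty assignment. **Theorem.** For every sentence $\varphi\in\mathrm{FO}(\le,\perp\!\!\!\perp_{\mathrm c},\mathrm{dep},\subseteq,\perp_{\mathrm c})$ there is a sentence $\varphi'\in\mathrm{FO}(\perp_{\mathrm c})$ of independence logic over the same vocabulary such that for every structure $\mathfrak A$ of that vocabulary, $\mathfrak A\models\varphi$ if and only if $\mathfrak A\models\varphi'$. -/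

import Mathlib

universe u v w

namespace TeamSemantics

/-- First-order variables. -/
abbrev Var := ℕ

/-- Assignments with the finite domain `D` and codomain `A`. -/
abbrev Assignment (D : Finset Var) (A : Type w) := D → A

/-- Teams with domain `D` and codomain `A`. For finite `A` every such set is finite. -/
abbrev Team (D : Finset Var) (A : Type w) := Set (Assignment D A)

section Teams

variable {D : Finset Var} {A : Type w}

/-- The assignment `s(a/x)`, whose domain is `D ∪ {x}`. -/
def Assignment.update (s : Assignment D A) (x : Var) (a : A) : Assignment (insert x D) A :=
  fun y => if h : y.1 = x then a else s ⟨y.1, Finset.mem_of_mem_insert_of_ne y.2 h⟩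

/-- The tuple `s(x₁), …, s(xₖ)`. -/
def Assignment.tuple (s : Assignment D A) {k : ℕ} (x : Fin k → D) : Fin k → A :=
  fun i => s (x i)

/-- The team `X[A/x]`. -/
def Team.duplicate (X : Team D A) (x : Var) : Team (insert x D) A :=
  {t | ∃ s ∈ X, ∃ a : A, t = Assignment.update s x a}

/-- The team `X[F/x]`, where `F` maps the elements of `X` to nonempty subsets of `A`. -/
def Team.supplement (X : Team D A) (x : Var) (F : X → {B : Set A // B.Nonempty}) :
    Team (insert x D) A :=
  {t | ∃ s : X, ∃ a ∈ (F s).1, t = Assignment.update s.1 x a}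

/-! ### Multiteams and the probabilistic atoms -/

/-- A multiteam `(X, m)`. -/
structure Multiteam (D : Finset Var) (A : Type w) where
  team : Team D A
  mult : team → ℕ

/-- The size `|(X, m)| = ∑_{s ∈ X} m(s)`, for finite `A`. -/
noncomputable def Multiteam.size (M : Multiteam D A) : ℕ :=
  ∑ᶠ s : M.team, M.mult s

open Classical in
/-- The multiteam `(X, m)_{x = a}`: the multiplicity of every `s ∈ X` with `s(x) ≠ a`
becomes `0`. -/
noncomputable def Multiteam.select (M : Multiteam D A) {k : ℕ} (x : Fin k → D)
    (a : Fin k → A) : Multiteam D A where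
  team := M.team
  mult := fun s => if Assignment.tuple s.1 x = a then M.mult s else 0

/-- `(X, m)` satisfies the probabilistic inclusion atom `x ≤ y`. The assignment `s` ranges over
all of `D → A`; only its restriction to the variables of `x` matters. -/
def Multiteam.ProbIncl (M : Multiteam D A) {k : ℕ} (x y : Fin k → D) : Prop :=
  ∀ s : Assignment D A, (M.select x (s.tuple x)).size ≤ (M.select y (s.tuple x)).size

/-- `(X, m)` satisfies the probabilistic conditional independence atom `y ⊥⊥_x z`. The
concatenation of tuples is `Fin.append`. -/
def Multiteam.ProbCondIndep (M : Multiteam D A) {k l n : ℕ}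
    (x : Fin k → D) (y : Fin l → D) (z : Fin n → D) : Prop :=
  ∀ s : Assignment D A,
    (M.select (Fin.append x y) (s.tuple (Fin.append x y))).size *
        (M.select (Fin.append x z) (s.tuple (Fin.append x z))).size =
      (M.select (Fin.append (Fin.append x y) z)
          (s.tuple (Fin.append (Fin.append x y) z))).size *
        (M.select x (s.tuple x)).size

/-- The multiteam `(X, 1)`. -/
def Team.toMultiteam (X : Team D A) : Multiteam D A := ⟨X, fun _ => 1⟩

/-! ### The dependency atoms of team semantics -/

/-- `X` satisfies the dependence atom `dep(x, y)`. -/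
def Team.Dep (X : Team D A) {k l : ℕ} (x : Fin k → D) (y : Fin l → D) : Prop :=
  ∀ s ∈ X, ∀ s' ∈ X, Assignment.tuple s x = Assignment.tuple s' x →
    Assignment.tuple s y = Assignment.tuple s' y

/-- `X` satisfies the inclusion atom `x ⊆ y`. -/
def Team.Incl (X : Team D A) {k : ℕ} (x y : Fin k → D) : Prop :=
  ∀ s ∈ X, ∃ s' ∈ X, Assignment.tuple s x = Assignment.tuple s' y

/-- `X` satisfies the conditional independence atom `y ⊥_x z`. -/
def Team.CondIndep (X : Team D A) {k l n : ℕ}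
    (x : Fin k → D) (y : Fin l → D) (z : Fin n → D) : Prop :=
  ∀ s ∈ X, ∀ s' ∈ X, Assignment.tuple s x = Assignment.tuple s' x →
    ∃ s'' ∈ X, Assignment.tuple s'' x = Assignment.tuple s x ∧
      Assignment.tuple s'' y = Assignment.tuple s y ∧
      Assignment.tuple s'' z = Assignment.tuple s' z

end Teams

/-! ### Syntax -/

/-- Formulas of first-order logic in negation normal form over the relation symbols of `L`,
together with the five kinds of dependency atoms. Tuples may have length `0`. -/
inductive Formula (L : FirstOrder.Language.{u, v}) : Type v
  | eq (x y : Var) : Formula L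
  | ne (x y : Var) : Formula L
  | rel {k : ℕ} (R : L.Relations k) (x : Fin k → Var) : Formula L
  | nrel {k : ℕ} (R : L.Relations k) (x : Fin k → Var) : Formula L
  /-- `x ≤ y` -/
  | probIncl {k : ℕ} (x y : Fin k → Var) : Formula L
  /-- `y ⊥⊥_x z` -/
  | probCondIndep {k l n : ℕ} (x : Fin k → Var) (y : Fin l → Var) (z : Fin n → Var) : Formula L
  /-- `dep(x, y)` -/
  | dep {k l : ℕ} (x : Fin k → Var) (y : Fin l → Var) : Formula L
  /-- `x ⊆ y` -/
  | incl {k : ℕ} (x y : Fin k → Var) : Formula L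
  /-- `y ⊥_x z` -/
  | condIndep {k l n : ℕ} (x : Fin k → Var) (y : Fin l → Var) (z : Fin n → Var) : Formula L
  | and (φ ψ : Formula L) : Formula L
  | or (φ ψ : Formula L) : Formula L
  | ex (x : Var) (φ : Formula L) : Formula L
  | all (x : Var) (φ : Formula L) : Formula L

/-- The five kinds of dependency atoms: `≤`, `⊥⊥_c`, `dep`, `⊆` and `⊥_c`. -/
inductive AtomKind
  | probIncl
  | probCondIndep
  | dep
  | incl
  | condIndep

/-- The set of variables listed in a tuple. -/
def tupleVars {k : ℕ} (x : Fin k → Var) : Finset Var := Finset.univ.image x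

namespace Formula

variable {L : FirstOrder.Language.{u, v}}

/-- `φ` is a formula of `FO(C)`: each of its dependency atoms is of a kind that belongs to `C`. -/
def InLogic (C : Set AtomKind) : Formula L → Prop
  | eq _ _ => True
  | ne _ _ => True
  | rel _ _ => True
  | nrel _ _ => True
  | probIncl _ _ => AtomKind.probIncl ∈ C
  | probCondIndep _ _ _ => AtomKind.probCondIndep ∈ C
  | dep _ _ => AtomKind.dep ∈ C
  | incl _ _ => AtomKind.incl ∈ C
  | condIndep _ _ _ => AtomKind.condIndep ∈ C
  | and φ ψ => φ.InLogic C ∧ ψ.InLogic C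
  | or φ ψ => φ.InLogic C ∧ ψ.InLogic C
  | ex _ φ => φ.InLogic C
  | all _ φ => φ.InLogic C

/-- The set of free variables. -/
def freeVars : Formula L → Finset Var
  | eq x y => {x, y}
  | ne x y => {x, y}
  | rel _ x => tupleVars x
  | nrel _ x => tupleVars x
  | probIncl x y => tupleVars x ∪ tupleVars y
  | probCondIndep x y z => tupleVars x ∪ tupleVars y ∪ tupleVars z
  | dep x y => tupleVars x ∪ tupleVars y
  | incl x y => tupleVars x ∪ tupleVars y
  | condIndep x y z => tupleVars x ∪ tupleVars y ∪ tupleVars z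
  | and φ ψ => φ.freeVars ∪ ψ.freeVars
  | or φ ψ => φ.freeVars ∪ ψ.freeVars
  | ex x φ => φ.freeVars.erase x
  | all x φ => φ.freeVars.erase x

end Formula

/-- A tuple of variables from `D`, as a tuple of elements of `D`. -/
def tupleIn {D : Finset Var} {k : ℕ} (x : Fin k → Var) (h : tupleVars x ⊆ D) : Fin k → D :=
  fun i => ⟨x i, h (Finset.mem_image_of_mem x (Finset.mem_univ i))⟩

/-! ### Semantics -/

/-- Lax team semantics: the satisfaction relation `A ⊨_X φ`, for teams `X` whose domain `D`
contains the free variables of `φ`. The probabilistic atoms are evaluated on `(X, 1)`. -/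
def Sat {L : FirstOrder.Language.{u, v}} (A : Type w) [L.Structure A] :
    (φ : Formula L) → (D : Finset Var) → φ.freeVars ⊆ D → Team D A → Prop
  | .eq x y, _, h, X => ∀ s ∈ X, s ⟨x, h (by simp [Formula.freeVars])⟩ =
      s ⟨y, h (by simp [Formula.freeVars])⟩
  | .ne x y, _, h, X => ∀ s ∈ X, s ⟨x, h (by simp [Formula.freeVars])⟩ ≠
      s ⟨y, h (by simp [Formula.freeVars])⟩
  | .rel R x, _, h, X =>
      ∀ s ∈ X, FirstOrder.Language.Structure.RelMap R (Assignment.tuple s (tupleIn x h))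
  | .nrel R x, _, h, X =>
      ∀ s ∈ X, ¬ FirstOrder.Language.Structure.RelMap R (Assignment.tuple s (tupleIn x h))
  | .probIncl x y, _, h, X =>
      X.toMultiteam.ProbIncl (tupleIn x (Finset.union_subset_left h))
        (tupleIn y (Finset.union_subset_right h))
  | .probCondIndep x y z, _, h, X =>
      X.toMultiteam.ProbCondIndep
        (tupleIn x (Finset.union_subset_left (Finset.union_subset_left h)))
        (tupleIn y (Finset.union_subset_right (Finset.union_subset_left h)))
        (tupleIn z (Finset.union_subset_right h))
  | .dep x y, _, h, X =>
      X.Dep (tupleIn x (Finset.union_subset_left h)) (tupleIn y (Finset.union_subset_right h))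
  | .incl x y, _, h, X =>
      X.Incl (tupleIn x (Finset.union_subset_left h)) (tupleIn y (Finset.union_subset_right h))
  | .condIndep x y z, _, h, X =>
      X.CondIndep
        (tupleIn x (Finset.union_subset_left (Finset.union_subset_left h)))
        (tupleIn y (Finset.union_subset_right (Finset.union_subset_left h)))
        (tupleIn z (Finset.union_subset_right h))
  | .and φ ψ, D, h, X =>
      Sat A φ D (Finset.union_subset_left h) X ∧ Sat A ψ D (Finset.union_subset_right h) X
  | .or φ ψ, D, h, X =>
      ∃ Y Z : Team D A, Y ⊆ X ∧ Z ⊆ X ∧ Y ∪ Z = X ∧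
        Sat A φ D (Finset.union_subset_left h) Y ∧ Sat A ψ D (Finset.union_subset_right h) Z
  | .ex x φ, D, h, X =>
      ∃ F : X → {B : Set A // B.Nonempty},
        Sat A φ (insert x D) (Finset.subset_insert_iff.mpr h) (X.supplement x F)
  | .all x φ, D, h, X =>
      Sat A φ (insert x D) (Finset.subset_insert_iff.mpr h) (X.duplicate x)

/-- The sentences of `FO(C)` over the vocabulary `L`. -/
structure Sentence (L : FirstOrder.Language.{u, v}) (C : Set AtomKind) where
  formula : Formula L
  inLogic : formula.InLogic C
  freeVars_eq : formula.freeVars = ∅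

/-- The unique assignment with empty domain. -/
def emptyAssignment (A : Type w) : Assignment ∅ A :=
  fun x => absurd x.2 (Finset.notMem_empty x.1)

/-- `A ⊨ φ`, that is, `φ` holds on the team `{∅}` of the empty assignment. -/
def Models {L : FirstOrder.Language.{u, v}} {C : Set AtomKind} (A : Type w) [L.Structure A]
    (φ : Sentence L C) : Prop :=
  Sat A φ.formula ∅ φ.freeVars_eq.subset {emptyAssignment A}

end TeamSemantics

/-!
Each atom other than conditional independence is replaced by a formula of independence logic that
means the same on teams with the domain `D` at hand; connectives and quantifiers stay as they are
(`TeamSemantics.exists_equivalent_condIndep`). No detour through existential second-order logic is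
needed.

* The atom `dep(x, y)` is `y ⊥_x y`.
* For `x ⊆ y`, let `p, q, r` range over all values and choose a tuple `z` that equals `y` if
  `p = q` or `r ≠ p`, and `x` otherwise. Then `z` ranges over the values of `y` when `p = q`, and
  over the values of `x` and `y` together when `p ≠ q`, so `z ⊥ pq` expresses the inclusion
  (`TeamSemantics.totalSat_inclF`).
* Let `d` list `D`. The atom `x ≤ y` holds in `(X, 1)` if and only if some injection `h : X → X`
  satisfies `h(s)(y) = s(x)` for all `s`: such an injection is assembled from injections
  between fibres. Values `w` for a copy of `d` that satisfy `w ⊆ d`, `dep(w, d)` and `w_y = x`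
  are such an injection (`TeamSemantics.totalSat_injF`).
* Let `P` be the set of pairs in `X × X` that agree on `x`. The two products in the atom
  `y ⊥⊥_x z` are the sizes of the fibres of `(s, s') ↦ s(xy)s'(z)` and `(t, t') ↦ t(xyz)`
  on `P`. All fibres of one map are as large as those of the other if and only if there is an
  injection `P → P` that carries one map into the other, because an injection of a finite set into
  itself is a bijection (`TeamSemantics.probCondIndep_iff_hasInjection`). With a second copy `d'`
  of `d`, the set `P` is the team given by `d' ⊆ d`, `d ⊆ d'`, `x' = x` and `d ⊥_x d'`, and the
  injection is expressed as before (`TeamSemantics.totalSat_pairInjF`).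

Independence logic is local, so its formulas are evaluated on teams of total assignments
(`TeamSemantics.sat_iff_totalSat`), where fresh variables need no change of domain.
-/

namespace TeamSemantics

/-! ### Team semantics over total assignments -/

/-- The team `T'` arises from the team `T` of total assignments by giving new values to the
variables listed in `l`: to each `s ∈ T` a nonempty set of value tuples. -/
def Reassign {A : Type w} (l : List Var) (T T' : Set (Var → A)) : Prop :=
  (∀ t ∈ T', ∃ s ∈ T, ∀ v ∉ l, t v = s v) ∧ ∀ s ∈ T, ∃ t ∈ T', ∀ v ∉ l, t v = s v

/-- The team that arises from `T` by giving all possible values to the variables listed in `l`. -/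
def saturate {A : Type w} (l : List Var) (T : Set (Var → A)) : Set (Var → A) :=
  {t | ∃ s ∈ T, ∀ v ∉ l, t v = s v}

/-- Satisfaction of independence logic in a team of assignments that are defined on all
variables. The four kinds of atoms outside independence logic are never used and are read as
false. -/
def TotalSat {L : FirstOrder.Language.{u, v}} (A : Type w) [L.Structure A] :
    Formula L → Set (Var → A) → Prop
  | .eq x y, T => ∀ s ∈ T, s x = s y
  | .ne x y, T => ∀ s ∈ T, s x ≠ s y
  | .rel R x, T => ∀ s ∈ T, FirstOrder.Language.Structure.RelMap R (s ∘ x)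
  | .nrel R x, T => ∀ s ∈ T, ¬ FirstOrder.Language.Structure.RelMap R (s ∘ x)
  | .probIncl _ _, _ => False
  | .probCondIndep _ _ _, _ => False
  | .dep _ _, _ => False
  | .incl _ _, _ => False
  | .condIndep x y z, T => ∀ s ∈ T, ∀ s' ∈ T, s ∘ x = s' ∘ x →
      ∃ s'' ∈ T, s'' ∘ x = s ∘ x ∧ s'' ∘ y = s ∘ y ∧ s'' ∘ z = s' ∘ z
  | .and φ ψ, T => TotalSat A φ T ∧ TotalSat A ψ T
  | .or φ ψ, T => ∃ Y Z : Set (Var → A), Y ∪ Z = T ∧ TotalSat A φ Y ∧ TotalSat A ψ Z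
  | .ex x φ, T => ∃ T', Reassign [x] T T' ∧ TotalSat A φ T'
  | .all x φ, T => TotalSat A φ (saturate [x] T)

/-- The restriction of a total assignment to the domain `D`. -/
def restrictTo {A : Type w} (D : Finset Var) (t : Var → A) : Assignment D A := fun v => t v

lemma restrictTo_insert {A : Type w} {D : Finset Var} {x : Var} {s t : Var → A}
    (h : ∀ v ∉ [x], t v = s v) :
    restrictTo (insert x D) t = Assignment.update (restrictTo D s) x (t x) := by
  funext v
  by_cases hv : v.1 = x
  · simp [restrictTo, Assignment.update, hv]
  · simp [restrictTo, Assignment.update, hv, h v.1 (by simpa using hv)]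

lemma restrictTo_update {A : Type w} {D : Finset Var} (x : Var) (s : Var → A) (a : A) :
    restrictTo (insert x D) (Function.update s x a) = Assignment.update (restrictTo D s) x a := by
  rw [restrictTo_insert (s := s) (fun v hv => by
    simp only [List.mem_singleton] at hv; simp [hv])]
  simp

lemma tuple_restrictTo {A : Type w} {D : Finset Var} {k : ℕ} (x : Fin k → Var)
    (h : tupleVars x ⊆ D) (t : Var → A) :
    (restrictTo D t).tuple (tupleIn x h) = t ∘ x := rfl

lemma duplicate_restrictTo {A : Type w} (D : Finset Var) (x : Var) (T : Set (Var → A)) :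
    restrictTo (insert x D) '' saturate [x] T = Team.duplicate (restrictTo D '' T) x := by
  ext u
  constructor
  · rintro ⟨t, ⟨s, hs, hst⟩, rfl⟩
    exact ⟨_, ⟨s, hs, rfl⟩, t x, restrictTo_insert hst⟩
  · rintro ⟨_, ⟨s, hs, rfl⟩, a, rfl⟩
    exact ⟨Function.update s x a, ⟨s, hs, fun v hv => by
      simp only [List.mem_singleton] at hv; simp [hv]⟩, restrictTo_update x s a⟩

/-- Independence logic is local: whether `X` satisfies `φ` can be decided on any team of total
assignments that restricts to `X`. -/
theorem sat_iff_totalSat {L : FirstOrder.Language.{u, v}} {A : Type w} [L.Structure A]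
    (φ : Formula L) (hφ : φ.InLogic {AtomKind.condIndep}) (D : Finset Var)
    (h : φ.freeVars ⊆ D) (T : Set (Var → A)) :
    Sat A φ D h (restrictTo D '' T) ↔ TotalSat A φ T := by
  induction φ generalizing D T with
  | eq x y => simp [Sat, TotalSat, restrictTo]
  | ne x y => simp [Sat, TotalSat, restrictTo]
  | rel R x => exact Set.forall_mem_image
  | nrel R x => exact Set.forall_mem_image
  | probIncl x y => simp [Formula.InLogic] at hφ
  | probCondIndep x y z => simp [Formula.InLogic] at hφ
  | dep x y => simp [Formula.InLogic] at hφ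
  | incl x y => simp [Formula.InLogic] at hφ
  | condIndep x y z => 
    simp only [Sat, TotalSat, Team.CondIndep, Set.forall_mem_image, Set.exists_mem_image,
      tuple_restrictTo]
  | and φ ψ ih₁ ih₂ => simp [Sat, TotalSat, ih₁ hφ.1, ih₂ hφ.2]
  | or φ ψ ih₁ ih₂ =>
    constructor
    · rintro ⟨Y, Z, hY, hZ, hYZ, h₁, h₂⟩
      refine ⟨T ∩ restrictTo D ⁻¹' Y, T ∩ restrictTo D ⁻¹' Z, ?_,
        (ih₁ hφ.1 D (Finset.union_subset_left h) _).1 ?_,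
        (ih₂ hφ.2 D (Finset.union_subset_right h) _).1 ?_⟩
      · rw [← Set.inter_union_distrib_left, ← Set.preimage_union, hYZ]
        exact Set.inter_eq_left.2 (Set.subset_preimage_image _ _)
      · rwa [Set.image_inter_preimage, Set.inter_eq_right.2 hY]
      · rwa [Set.image_inter_preimage, Set.inter_eq_right.2 hZ]
    · rintro ⟨Y, Z, rfl, h₁, h₂⟩
      exact ⟨_, _, Set.image_mono Set.subset_union_left, Set.image_mono Set.subset_union_right,
        (Set.image_union _ _ _).symm, (ih₁ hφ.1 D _ _).2 h₁, (ih₂ hφ.2 D _ _).2 h₂⟩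
  | all x φ ih =>
    simp only [Sat, TotalSat]
    rw [← duplicate_restrictTo, ih hφ]
  | ex x φ ih =>
    have h' : φ.freeVars ⊆ insert x D := Finset.subset_insert_iff.mpr h
    constructor
    · rintro ⟨F, hF⟩
      refine ⟨{t | ∃ s, ∃ hs : s ∈ T, t x ∈ (F ⟨_, s, hs, rfl⟩).1 ∧ ∀ v ∉ [x], t v = s v},
        ⟨?_, ?_⟩, ?_⟩
      · rintro t ⟨s, hs, -, hst⟩
        exact ⟨s, hs, hst⟩
      · intro s hs
        obtain ⟨a, ha⟩ := (F ⟨_, s, hs, rfl⟩).2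
        have hst : ∀ v ∉ [x], Function.update s x a v = s v := fun v hv => by
          simp only [List.mem_singleton] at hv; simp [hv]
        exact ⟨Function.update s x a, ⟨s, hs, by simpa using ha, hst⟩, hst⟩
      · rw [← ih hφ (insert x D) h']
        convert hF using 1
        ext u
        constructor
        · rintro ⟨t, ⟨s, hs, ht, hst⟩, rfl⟩
          exact ⟨_, t x, ht, restrictTo_insert hst⟩
        · rintro ⟨⟨_, s, hs, rfl⟩, a, ha, rfl⟩
          exact ⟨Function.update s x a, ⟨s, hs, by simpa using ha, fun v hv => by
            simp only [List.mem_singleton] at hv; simp [hv]⟩, restrictTo_update x s a⟩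
    · rintro ⟨T', ⟨h₁, h₂⟩, hT'⟩
      -- Assignments in `T` with the same restriction pool the values that they are given in `T'`.
      refine ⟨fun s => ⟨{a | ∃ t ∈ T, ∃ t' ∈ T', restrictTo D t = s.1 ∧
        (∀ v ∉ [x], t' v = t v) ∧ t' x = a}, ?_⟩, ?_⟩
      · obtain ⟨_, t, ht, rfl⟩ := s
        obtain ⟨t', ht', htt⟩ := h₂ t ht
        exact ⟨t' x, t, ht, t', ht', rfl, htt, rfl⟩
      · rw [← ih hφ (insert x D) h'] at hT'
        convert hT' using 1
        ext u
        constructor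
        · rintro ⟨s, _, ⟨t, ht, t', ht', hs, htt, rfl⟩, rfl⟩
          exact ⟨t', ht', by rw [restrictTo_insert htt, hs]⟩
        · rintro ⟨t', ht', rfl⟩
          obtain ⟨t, ht, htt⟩ := h₁ t' ht'
          exact ⟨⟨_, t, ht, rfl⟩, t' x, ⟨t, ht, t', ht', rfl, htt, rfl⟩, restrictTo_insert htt⟩

/-! ### Blocks of quantifiers and conjunctions of equations -/

namespace Formula

variable {L : FirstOrder.Language.{u, v}}

/-- `∃ x₁ … ∃ xₙ φ`, for `l = [x₁, …, xₙ]`. -/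
def exs (l : List Var) (φ : Formula L) : Formula L := l.foldr ex φ

/-- `∀ x₁ … ∀ xₙ φ`, for `l = [x₁, …, xₙ]`. -/
def alls (l : List Var) (φ : Formula L) : Formula L := l.foldr all φ

/-- `x₁ = y₁ ∧ … ∧ xₙ = yₙ ∧ φ`, for `l = [(x₁, y₁), …, (xₙ, yₙ)]`. -/
def andEqs (l : List (Var × Var)) (φ : Formula L) : Formula L :=
  l.foldr (fun p ψ => (eq p.1 p.2).and ψ) φ

@[simp] lemma inLogic_exs {C : Set AtomKind} (l : List Var) (φ : Formula L) :
    (exs l φ).InLogic C ↔ φ.InLogic C := by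
  induction l with
  | nil => rfl
  | cons x l ih => exact ih

@[simp] lemma inLogic_alls {C : Set AtomKind} (l : List Var) (φ : Formula L) :
    (alls l φ).InLogic C ↔ φ.InLogic C := by
  induction l with
  | nil => rfl
  | cons x l ih => exact ih

@[simp] lemma inLogic_andEqs {C : Set AtomKind} (l : List (Var × Var)) (φ : Formula L) :
    (andEqs l φ).InLogic C ↔ φ.InLogic C := by
  induction l with
  | nil => rfl
  | cons x l ih => exact (iff_of_eq (true_and _)).trans ih

lemma mem_freeVars_exs (l : List Var) (φ : Formula L) (v : Var) :
    v ∈ (exs l φ).freeVars ↔ v ∈ φ.freeVars ∧ v ∉ l := by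
  induction l with
  | nil => simp [exs]
  | cons x l ih =>
    change v ∈ (exs l φ).freeVars.erase x ↔ _
    simp only [Finset.mem_erase, ih, List.mem_cons]
    tauto

lemma mem_freeVars_alls (l : List Var) (φ : Formula L) (v : Var) :
    v ∈ (alls l φ).freeVars ↔ v ∈ φ.freeVars ∧ v ∉ l := by
  induction l with
  | nil => simp [alls]
  | cons x l ih =>
    change v ∈ (alls l φ).freeVars.erase x ↔ _
    simp only [Finset.mem_erase, ih, List.mem_cons]
    tauto

lemma mem_freeVars_andEqs (l : List (Var × Var)) (φ : Formula L) (v : Var) :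
    v ∈ (andEqs l φ).freeVars ↔ (∃ p ∈ l, v = p.1 ∨ v = p.2) ∨ v ∈ φ.freeVars := by
  induction l with
  | nil => simp [andEqs]
  | cons x l ih =>
    change v ∈ ({x.1, x.2} : Finset Var) ∪ (andEqs l φ).freeVars ↔ _
    simp only [Finset.mem_union, ih, List.exists_mem_cons_iff, Finset.mem_insert,
      Finset.mem_singleton, or_assoc]

end Formula

section TotalSat

variable {L : FirstOrder.Language.{u, v}} {A : Type w} [L.Structure A]

lemma reassign_nil {T T' : Set (Var → A)} : Reassign [] T T' ↔ T' = T := by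
  constructor
  · rintro ⟨h₁, h₂⟩
    ext t
    constructor
    · intro ht
      obtain ⟨s, hs, h⟩ := h₁ t ht
      rwa [funext fun v => h v (by simp)]
    · intro hs
      obtain ⟨t', ht, h⟩ := h₂ t hs
      rwa [← funext fun v => h v (by simp)]
  · rintro rfl
    exact ⟨fun t ht => ⟨t, ht, fun _ _ => rfl⟩, fun t ht => ⟨t, ht, fun _ _ => rfl⟩⟩

lemma reassign_cons {x : Var} {l : List Var} {T T' : Set (Var → A)} :
    Reassign (x :: l) T T' ↔ ∃ T₁, Reassign [x] T T₁ ∧ Reassign l T₁ T' := by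
  constructor
  · rintro ⟨h₁, h₂⟩
    have hu : ∀ (s t : Var → A), ∀ v ∉ [x], Function.update s x (t x) v = s v := fun s t v hv => by
      simp only [List.mem_singleton] at hv; simp [hv]
    have hu' : ∀ {s t : Var → A}, (∀ v ∉ x :: l, t v = s v) →
        ∀ v ∉ l, t v = Function.update s x (t x) v := fun {s t} hst v hv => by
      by_cases hx : v = x
      · subst hx; simp
      · rw [Function.update_of_ne hx]
        exact hst v (by simp [hx, hv])
    refine ⟨{u | ∃ s ∈ T, ∃ t ∈ T', (∀ v ∉ x :: l, t v = s v) ∧ u = Function.update s x (t x)},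
      ⟨?_, ?_⟩, ?_, ?_⟩
    · rintro _ ⟨s, hs, t, -, -, rfl⟩
      exact ⟨s, hs, hu s t⟩
    · intro s hs
      obtain ⟨t, ht, hst⟩ := h₂ s hs
      exact ⟨_, ⟨s, hs, t, ht, hst, rfl⟩, hu s t⟩
    · intro t ht
      obtain ⟨s, hs, hst⟩ := h₁ t ht
      exact ⟨_, ⟨s, hs, t, ht, hst, rfl⟩, hu' hst⟩
    · rintro _ ⟨s, hs, t, ht, hst, rfl⟩
      exact ⟨t, ht, hu' hst⟩
  · rintro ⟨T₁, ⟨h₁, h₂⟩, h₃, h₄⟩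
    constructor
    · intro t ht
      obtain ⟨u, hu, hut⟩ := h₃ t ht
      obtain ⟨s, hs, hsu⟩ := h₁ u hu
      exact ⟨s, hs, fun v hv => by
        simp only [List.mem_cons, not_or] at hv
        rw [hut v hv.2, hsu v (by simpa using hv.1)]⟩
    · intro s hs
      obtain ⟨u, hu, hsu⟩ := h₂ s hs
      obtain ⟨t, ht, hut⟩ := h₄ u hu
      exact ⟨t, ht, fun v hv => by
        simp only [List.mem_cons, not_or] at hv
        rw [hut v hv.2, hsu v (by simpa using hv.1)]⟩

lemma totalSat_exs (l : List Var) (φ : Formula L) (T : Set (Var → A)) :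
    TotalSat A (Formula.exs l φ) T ↔ ∃ T', Reassign l T T' ∧ TotalSat A φ T' := by
  induction l generalizing T with
  | nil => simp [reassign_nil, Formula.exs]
  | cons x l ih =>
    change (∃ T₁, Reassign [x] T T₁ ∧ TotalSat A (Formula.exs l φ) T₁) ↔ _
    constructor
    · rintro ⟨T₁, h₁, hT₁⟩
      obtain ⟨T', h₂, h⟩ := (ih T₁).1 hT₁
      exact ⟨T', reassign_cons.2 ⟨T₁, h₁, h₂⟩, h⟩
    · rintro ⟨T', hT', h⟩
      obtain ⟨T₁, h₁, h₂⟩ := reassign_cons.1 hT'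
      exact ⟨T₁, h₁, (ih T₁).2 ⟨T', h₂, h⟩⟩

lemma reassign_saturate (l : List Var) (T : Set (Var → A)) : Reassign l T (saturate l T) :=
  ⟨fun _ ht => ht, fun s hs => ⟨s, ⟨s, hs, fun _ _ => rfl⟩, fun _ _ => rfl⟩⟩

lemma saturate_cons (x : Var) (l : List Var) (T : Set (Var → A)) :
    saturate (x :: l) T = saturate l (saturate [x] T) := by
  ext t
  constructor
  · rintro ⟨s, hs, hst⟩
    refine ⟨Function.update s x (t x), ⟨s, hs, fun v hv => ?_⟩, fun v hv => ?_⟩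
    · simp only [List.mem_singleton] at hv; simp [hv]
    · by_cases hx : v = x
      · subst hx; simp
      · rw [Function.update_of_ne hx]
        exact hst v (by simp [hx, hv])
  · rintro ⟨u, ⟨s, hs, hsu⟩, hut⟩
    exact ⟨s, hs, fun v hv => by
      simp only [List.mem_cons, not_or] at hv
      rw [hut v hv.2, hsu v (by simpa using hv.1)]⟩

lemma totalSat_alls (l : List Var) (φ : Formula L) (T : Set (Var → A)) :
    TotalSat A (Formula.alls l φ) T ↔ TotalSat A φ (saturate l T) := by
  induction l generalizing T with
  | nil =>
    have : saturate [] T = T := reassign_nil.1 (reassign_saturate [] T)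
    rw [this]; rfl
  | cons x l ih =>
    change TotalSat A (Formula.alls l φ) (saturate [x] T) ↔ _
    rw [ih, ← saturate_cons]

lemma totalSat_andEqs (l : List (Var × Var)) (φ : Formula L) (T : Set (Var → A)) :
    TotalSat A (Formula.andEqs l φ) T ↔
      (∀ t ∈ T, ∀ p ∈ l, t p.1 = t p.2) ∧ TotalSat A φ T := by
  induction l with
  | nil => simp [Formula.andEqs]
  | cons p l ih =>
    change (∀ t ∈ T, t p.1 = t p.2) ∧ TotalSat A (Formula.andEqs l φ) T ↔ _
    simp only [ih, List.forall_mem_cons, ← and_assoc]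
    simp only [forall_and]

/-- A disjunction of two flat formulas is flat. -/
lemma totalSat_or_of_flat {φ ψ : Formula L} {P Q : (Var → A) → Prop}
    (hφ : ∀ T, TotalSat A φ T ↔ ∀ t ∈ T, P t) (hψ : ∀ T, TotalSat A ψ T ↔ ∀ t ∈ T, Q t)
    (T : Set (Var → A)) : TotalSat A (φ.or ψ) T ↔ ∀ t ∈ T, P t ∨ Q t := by
  constructor
  · rintro ⟨Y, Z, rfl, h₁, h₂⟩ t (ht | ht)
    · exact Or.inl ((hφ _).1 h₁ t ht)
    · exact Or.inr ((hψ _).1 h₂ t ht)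
  · intro h
    refine ⟨{t ∈ T | P t}, {t ∈ T | Q t}, ?_, (hφ _).2 fun t ht => ht.2,
      (hψ _).2 fun t ht => ht.2⟩
    ext t
    constructor
    · rintro (ht | ht) <;> exact ht.1
    · intro ht
      exact (h t ht).imp (fun h => ⟨ht, h⟩) fun h => ⟨ht, h⟩

end TotalSat

/-! ### Dependence and inclusion atoms in independence logic -/

namespace Formula

variable {L : FirstOrder.Language.{u, v}}

/-- A variable above all entries of the tuple `x`. -/
def freshVar {k : ℕ} (x : Fin k → Var) : ℕ := (tupleVars x).sup id + 1

/-- The tuple `xₘ, …, xₘ₊ₖ₋₁` of consecutive variables. -/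
def varBlock (m k : ℕ) : Fin k → ℕ := fun i => m + i

/-- Pairs the entries of two tuples of variables. -/
def zipTuples {k : ℕ} (x y : Fin k → Var) : List (Var × Var) := List.ofFn fun i => (x i, y i)

/-- The dependence atom `dep(x, y)`, written as `y ⊥_x y`. -/
def depF {k l : ℕ} (x : Fin k → Var) (y : Fin l → Var) : Formula L := condIndep x y y

/-- The inclusion atom `x ⊆ y`, written as
`∀ p q r ∃ z (((z = y ∧ (p = q ∨ r ≠ p)) ∨ (z = x ∧ p ≠ q ∧ r = p)) ∧ z ⊥ pq)`
with fresh variables `p, q, r, z`. -/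
def inclF {k : ℕ} (x y : Fin k → Var) : Formula L :=
  let m := freshVar (Fin.append x y)
  let z := varBlock (m + 3) k
  alls [m, m + 1, m + 2] (exs (List.ofFn z)
    (((andEqs (zipTuples z y) ((eq m (m + 1)).or (ne (m + 2) m))).or
      (andEqs (zipTuples z x) ((ne m (m + 1)).and (eq (m + 2) m)))).and
        (condIndep ![] z ![m, m + 1])))

lemma lt_freshVar {k : ℕ} (x : Fin k → ℕ) (i : Fin k) : x i < freshVar x :=
  Nat.lt_succ_of_le (Finset.le_sup (f := id) (Finset.mem_image_of_mem x (Finset.mem_univ i)))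

lemma varBlock_injective (m k : ℕ) : Function.Injective (varBlock m k) := fun _ _ h =>
  Fin.ext (Nat.add_left_cancel h)

lemma mem_tupleVars {k : ℕ} {x : Fin k → Var} {v : Var} : v ∈ tupleVars x ↔ ∃ i, x i = v := by
  simp [tupleVars]

lemma inLogic_depF {k l : ℕ} (x : Fin k → Var) (y : Fin l → Var) :
    (depF x y : Formula L).InLogic {AtomKind.condIndep} := rfl

lemma inLogic_inclF {k : ℕ} (x y : Fin k → Var) :
    (inclF x y : Formula L).InLogic {AtomKind.condIndep} := by
  simp [inclF, InLogic]

lemma freeVars_depF {k l : ℕ} (x : Fin k → Var) (y : Fin l → Var) :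
    (depF x y : Formula L).freeVars = tupleVars x ∪ tupleVars y := by
  simp [depF, freeVars, Finset.union_assoc]

lemma freeVars_inclF {k : ℕ} (x y : Fin k → Var) :
    (inclF x y : Formula L).freeVars ⊆ tupleVars x ∪ tupleVars y := by
  intro v
  simp only [inclF, mem_freeVars_alls, mem_freeVars_exs, freeVars, Finset.mem_union,
    mem_freeVars_andEqs, zipTuples, List.mem_ofFn, mem_tupleVars, List.mem_cons,
    Finset.mem_insert, Finset.mem_singleton, Fin.exists_fin_two]
  simp only [Matrix.cons_val_zero, Matrix.cons_val_one, List.not_mem_nil, or_false,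
    IsEmpty.exists_iff, exists_exists_eq_and, false_or]
  grind

end Formula

section TotalSat

open Formula

variable {L : FirstOrder.Language.{u, v}} {A : Type w} [L.Structure A]

lemma comp_eq_comp_of_eq {s t : Var → A} {k : ℕ} {x : Fin k → Var} (h : ∀ i, s (x i) = t (x i)) :
    s ∘ x = t ∘ x := funext h

/-- Every tuple of values can be assigned to a block of variables. -/
lemma exists_eqOn_varBlock {n : ℕ} (m : ℕ) (s : Var → A) (a : Fin n → A) :
    ∃ t : Var → A, (∀ v ∉ List.ofFn (varBlock m n), t v = s v) ∧ t ∘ varBlock m n = a :=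
  ⟨Function.extend (varBlock m n) a s,
    fun _ hv => Function.extend_apply' _ _ _ fun ⟨i, hi⟩ => hv (List.mem_ofFn.2 ⟨i, hi⟩),
    Function.extend_comp (varBlock_injective m n) a s⟩

/-- Reassigning a block of variables above all entries of `d` does not change the value of `d`. -/
lemma comp_eq_of_eqOn_varBlock {k n m : ℕ} {d : Fin k → ℕ} (hm : ∀ i, d i < m) {s t : Var → A}
    (h : ∀ v ∉ List.ofFn (varBlock m n), t v = s v) : t ∘ d = s ∘ d :=
  comp_eq_comp_of_eq fun i => h _ fun hi => by
    obtain ⟨j, hj⟩ := List.mem_ofFn.1 hi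
    have := hm i
    simp only [varBlock] at hj
    omega

lemma forall_mem_zipTuples {k : ℕ} {x y : Fin k → Var} {t : Var → A} :
    (∀ p ∈ zipTuples x y, t p.1 = t p.2) ↔ t ∘ x = t ∘ y := by
  simp [zipTuples, funext_iff]

lemma totalSat_depF {k l : ℕ} (x : Fin k → Var) (y : Fin l → Var) (T : Set (Var → A)) :
    TotalSat A (depF x y : Formula L) T ↔ ∀ s ∈ T, ∀ s' ∈ T, s ∘ x = s' ∘ x → s ∘ y = s' ∘ y := by
  constructor
  · intro h s hs s' hs' hx
    obtain ⟨s'', -, -, h₁, h₂⟩ := h s hs s' hs' hx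
    exact h₁.symm.trans h₂
  · intro h s hs s' hs' hx
    exact ⟨s, hs, rfl, rfl, h s hs s' hs' hx⟩

/-- The meaning of `inclF`. The tuple `z` takes the values of `y` when `p = q`, and the values of
both `x` and `y` when `p ≠ q`. Independence of `z` from `pq` makes the two ranges equal. On a
structure with one element the case `p ≠ q` is void, and inclusion is trivial. -/
theorem totalSat_inclF {k : ℕ} (x y : Fin k → ℕ) (T : Set (Var → A)) :
    TotalSat A (inclF x y : Formula L) T ↔ ∀ s ∈ T, ∃ s' ∈ T, s ∘ x = s' ∘ y := by
  set m := freshVar (Fin.append x y)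
  have hxm : ∀ i, x i < m := fun i => by
    simpa only [Fin.append_left] using lt_freshVar (Fin.append x y) (Fin.castAdd k i)
  have hym : ∀ i, y i < m := fun i => by
    simpa only [Fin.append_right] using lt_freshVar (Fin.append x y) (Fin.natAdd k i)
  set z := varBlock (m + 3) k
  have hzm : ∀ i, m + 3 ≤ z i := fun i => Nat.le_add_right _ _
  have hflat : ∀ T' : Set (Var → A), TotalSat A
      ((andEqs (zipTuples z y) ((eq m (m + 1)).or (ne (m + 2) m))).or
        (andEqs (zipTuples z x) ((ne m (m + 1)).and (eq (m + 2) m))) : Formula L) T' ↔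
      ∀ t ∈ T', (t ∘ z = t ∘ y ∧ (t m = t (m + 1) ∨ t (m + 2) ≠ t m)) ∨
        (t ∘ z = t ∘ x ∧ t m ≠ t (m + 1) ∧ t (m + 2) = t m) := by
    refine totalSat_or_of_flat (fun T' => ?_) fun T' => ?_
    · rw [totalSat_andEqs, totalSat_or_of_flat (fun _ => Iff.rfl) (fun _ => Iff.rfl)]
      simp only [forall_mem_zipTuples, ← forall_and]
    · rw [totalSat_andEqs]
      simp only [forall_mem_zipTuples, TotalSat, ← forall_and]
  change TotalSat A (alls [m, m + 1, m + 2] (exs (List.ofFn z) (and _ _))) T ↔ _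
  rw [totalSat_alls, totalSat_exs]
  have hout : ∀ {v : ℕ}, v < m → v ∉ List.ofFn z ∧ v ∉ [m, m + 1, m + 2] := fun {v} hv => by
    simp only [List.mem_ofFn, List.mem_cons, List.not_mem_nil, or_false]
    refine ⟨?_, by omega⟩
    rintro ⟨i, rfl⟩
    have := hzm i
    omega
  have hpqr : ∀ {v : ℕ}, v < m + 3 → v ∉ List.ofFn z := fun {v} hv => by
    simp only [List.mem_ofFn]
    rintro ⟨i, rfl⟩
    have := hzm i
    omega
  constructor
  · rintro ⟨T', ⟨h₁, h₂⟩, hT', hind⟩ s hs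
    rw [hflat] at hT'
    by_cases hxy : s ∘ x = s ∘ y
    · exact ⟨s, hs, hxy⟩
    obtain ⟨i, hi⟩ := Function.ne_iff.1 hxy
    set a := s (x i)
    set b := s (y i)
    -- The rows with `p = r = a` and `q = b` carry `z = x`, and those with `q = a` force `z = y`.
    have key : ∀ c, ∃ t ∈ T', t m = a ∧ t (m + 1) = c ∧ t (m + 2) = a ∧
        ∀ v : ℕ, v < m → t v = s v := by
      intro c
      let s₁ : Var → A := fun v =>
        if v = m then a else if v = m + 1 then c else if v = m + 2 then a else s v
      obtain ⟨t, ht, hst⟩ := h₂ s₁ ⟨s, hs, fun v hv => by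
        simp only [List.mem_cons, List.not_mem_nil, or_false, not_or] at hv
        simp [s₁, hv]⟩
      refine ⟨t, ht, ?_, ?_, ?_, ?_⟩
      · rw [hst _ (hpqr (by omega))]; simp [s₁]
      · rw [hst _ (hpqr (by omega))]; simp [s₁]
      · rw [hst _ (hpqr (by omega))]; simp [s₁]
      · intro v hv
        rw [hst _ (hout hv).1]
        simp [s₁, show v ≠ m by omega, show v ≠ m + 1 by omega, show v ≠ m + 2 by omega]
    obtain ⟨t, ht, htp, htq, htr, hts⟩ := key b
    obtain ⟨t', ht', htp', htq', -, -⟩ := key a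
    obtain ⟨u, hu, -, huz, hupq⟩ := hind t ht t' ht' (Subsingleton.elim _ _)
    have hup : u m = a := (congrFun hupq 0).trans htp'
    have huq : u (m + 1) = a := (congrFun hupq 1).trans htq'
    have htz : t ∘ z = t ∘ x := by
      rcases hT' t ht with ⟨-, h | h⟩ | h
      · exact absurd (htp.symm.trans (h.trans htq)) hi
      · exact absurd (htr.trans htp.symm) h
      · exact h.1
    have huz' : u ∘ z = u ∘ y := by
      rcases hT' u hu with h | h
      · exact h.1
      · exact absurd (hup.trans huq.symm) h.2.1
    obtain ⟨u₁, ⟨s', hs', hsu⟩, huu⟩ := h₁ u hu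
    refine ⟨s', hs', ?_⟩
    calc s ∘ x = t ∘ x := comp_eq_comp_of_eq fun i => (hts _ (hxm i)).symm
      _ = u ∘ y := by rw [← htz, ← huz, huz']
      _ = s' ∘ y := comp_eq_comp_of_eq fun i => by
        rw [huu _ (hout (hym i)).1, hsu _ (hout (hym i)).2]
  · intro h
    refine ⟨{t | (∃ u ∈ saturate [m, m + 1, m + 2] T, ∀ v ∉ List.ofFn z, t v = u v) ∧
      ((t ∘ z = t ∘ y ∧ (t m = t (m + 1) ∨ t (m + 2) ≠ t m)) ∨
        (t ∘ z = t ∘ x ∧ t m ≠ t (m + 1) ∧ t (m + 2) = t m))}, ⟨fun t ht => ht.1, ?_⟩,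
      (hflat _).2 fun t ht => ht.2, ?_⟩
    · intro u hu
      have key : ∀ x' : Fin k → ℕ, (∀ i, x' i < m) → ∃ t : Var → A,
          (∀ v ∉ List.ofFn z, t v = u v) ∧ t ∘ z = t ∘ x' := by
        intro x' hx'
        obtain ⟨t, ht, htz⟩ := exists_eqOn_varBlock (m + 3) u (u ∘ x')
        exact ⟨t, ht, htz.trans
          (comp_eq_of_eqOn_varBlock (fun i => (hx' i).trans (by omega)) ht).symm⟩
      by_cases hc : u m = u (m + 1) ∨ u (m + 2) ≠ u m
      · obtain ⟨t, ht, htz⟩ := key y hym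
        refine ⟨t, ⟨⟨u, hu, ht⟩, Or.inl ⟨htz, ?_⟩⟩, ht⟩
        rwa [ht _ (hpqr (by omega)), ht _ (hpqr (by omega)), ht _ (hpqr (by omega))]
      · obtain ⟨t, ht, htz⟩ := key x hxm
        refine ⟨t, ⟨⟨u, hu, ht⟩, Or.inr ⟨htz, ?_⟩⟩, ht⟩
        rw [ht _ (hpqr (by omega)), ht _ (hpqr (by omega)), ht _ (hpqr (by omega))]
        simpa [not_or] using hc
    · rintro t ⟨⟨u, ⟨s, hs, hsu⟩, hut⟩, ht⟩ t' - -
      have hts : ∀ v : ℕ, v < m → t v = s v := fun v hv => by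
        rw [hut _ (hout hv).1, hsu _ (hout hv).2]
      obtain ⟨s', hs', hs'z⟩ : ∃ s' ∈ T, t ∘ z = s' ∘ y := by
        rcases ht with ht | ht
        · exact ⟨s, hs, ht.1.trans (comp_eq_comp_of_eq fun i => hts _ (hym i))⟩
        · obtain ⟨s', hs', h'⟩ := h s hs
          exact ⟨s', hs', (ht.1.trans (comp_eq_comp_of_eq fun i => hts _ (hxm i))).trans h'⟩
      -- The value `t' (m + 1)` for `r` licenses `z = y` whether or not `p = q`.
      let w₀ : ℕ → A := fun v =>
        if v = m then t' m else if v = m + 1 ∨ v = m + 2 then t' (m + 1) else s' v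
      let w : ℕ → A := fun v => if v ∈ List.ofFn z then t v else w₀ v
      have hw : ∀ v ∉ List.ofFn z, w v = w₀ v := fun v hv => if_neg hv
      have hwz : w ∘ z = t ∘ z := comp_eq_comp_of_eq fun i =>
        if_pos (List.mem_ofFn.2 ⟨i, rfl⟩)
      have hwy : w ∘ y = s' ∘ y := comp_eq_comp_of_eq fun i => by
        have := hym i
        rw [hw _ (hout (hym i)).1]
        simp only [w₀]
        rw [if_neg (by omega), if_neg (by omega)]
      have hwp : w m = t' m := by rw [hw _ (hpqr (by omega))]; simp [w₀]
      have hwq : w (m + 1) = t' (m + 1) := by rw [hw _ (hpqr (by omega))]; simp [w₀]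
      have hwr : w (m + 2) = t' (m + 1) := by rw [hw _ (hpqr (by omega))]; simp [w₀]
      refine ⟨w, ⟨⟨w₀, ⟨s', hs', ?_⟩, hw⟩, Or.inl ⟨?_, ?_⟩⟩, Subsingleton.elim _ _, hwz, ?_⟩
      · intro v hv
        simp only [List.mem_cons, List.not_mem_nil, or_false, not_or] at hv
        simp [w₀, hv]
      · rw [hwz, hwy, hs'z]
      · rw [hwp, hwq, hwr]
        by_cases hc : t' m = t' (m + 1)
        · exact Or.inl hc
        · exact Or.inr fun h => hc h.symm
      · funext j
        fin_cases j
        · exact hwp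
        · exact hwq

end TotalSat

/-! ### Injections of a team into itself -/

/-- There is an injective map `h` from `R` to `R` such that `E r (h r)` for all `r ∈ R`. -/
def HasInjection {α : Type*} (R : Set α) (E : α → α → Prop) : Prop :=
  ∃ h : α → α, Set.MapsTo h R R ∧ Set.InjOn h R ∧ ∀ r ∈ R, E r (h r)

lemma hasInjection_image {α β : Type*} (Φ : α ≃ β) (R : Set α) (E : β → β → Prop) :
    HasInjection (Φ '' R) E ↔ HasInjection R fun a b => E (Φ a) (Φ b) := by
  constructor
  · rintro ⟨h, h₁, h₂, h₃⟩
    refine ⟨Φ.symm ∘ h ∘ Φ, fun r hr => ?_, fun r hr r' hr' hrr => ?_, fun r hr => ?_⟩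
    · obtain ⟨r', hr', h'⟩ := h₁ (Set.mem_image_of_mem Φ hr)
      simpa [← h'] using hr'
    · exact Φ.injective (h₂ (Set.mem_image_of_mem Φ hr) (Set.mem_image_of_mem Φ hr')
        (Φ.symm.injective hrr))
    · simpa using h₃ _ (Set.mem_image_of_mem Φ hr)
  · rintro ⟨h, h₁, h₂, h₃⟩
    refine ⟨Φ ∘ h ∘ Φ.symm, ?_, ?_, ?_⟩
    · rintro _ ⟨r, hr, rfl⟩
      simpa using h₁ hr
    · rintro _ ⟨r, hr, rfl⟩ _ ⟨r', hr', rfl⟩ hrr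
      simp only [Function.comp_apply, Equiv.symm_apply_apply, EmbeddingLike.apply_eq_iff_eq] at hrr
      rw [h₂ hr hr' hrr]
    · rintro _ ⟨r, hr, rfl⟩
      simpa using h₃ r hr

/-- An injection that carries the fibres of `f` into those of `g` can be put together from
injections between the individual fibres. -/
lemma hasInjection_of_ncard_le {α β : Type*} {R : Set α} (hR : R.Finite) {f g : α → β}
    (h : ∀ r ∈ R, {r' ∈ R | f r' = f r}.ncard ≤ {r' ∈ R | g r' = f r}.ncard) :
    HasInjection R fun r r' => g r' = f r := by
  have key : ∀ q, ∃ k : α → α, ∀ r ∈ R, f r = q →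
      Set.MapsTo k {r' ∈ R | f r' = q} {r' ∈ R | g r' = q} ∧
        Set.InjOn k {r' ∈ R | f r' = q} := by
    intro q
    by_cases hq : ∃ r ∈ R, f r = q
    · obtain ⟨r, hr, rfl⟩ := hq
      have : Nonempty α := ⟨r⟩
      have hle := h r hr
      rw [← Nat.cast_le (α := ℕ∞), (hR.subset (Set.sep_subset _ _)).cast_ncard_eq,
        (hR.subset (Set.sep_subset _ _)).cast_ncard_eq] at hle
      obtain ⟨k, hk₁, hk₂⟩ := (hR.subset (Set.sep_subset _ _)).exists_injOn_of_encard_le hle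
      exact ⟨k, fun _ _ _ => ⟨hk₁, hk₂⟩⟩
    · exact ⟨id, fun r hr hrq => absurd ⟨r, hr, hrq⟩ hq⟩
  choose k hk using key
  have hmem : ∀ r ∈ R, k (f r) r ∈ {r' ∈ R | g r' = f r} := fun r hr =>
    (hk (f r) r hr rfl).1 ⟨hr, rfl⟩
  refine ⟨fun r => k (f r) r, fun r hr => (hmem r hr).1, fun r hr r' hr' hrr => ?_,
    fun r hr => (hmem r hr).2⟩
  have hf : f r = f r' := by
    rw [← (hmem r hr).2, ← (hmem r' hr').2]
    exact congrArg g hrr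
  exact (hk (f r) r hr rfl).2 ⟨hr, rfl⟩ ⟨hr', hf.symm⟩ (by simpa [hf] using hrr)

/-- An injection of a finite set into itself is a bijection, so it makes corresponding fibres
equally large. -/
lemma HasInjection.ncard_eq {α β : Type*} {R : Set α} (hR : R.Finite) {f g : α → β}
    (h : HasInjection R fun r r' => g r' = f r) (q : β) :
    {r ∈ R | f r = q}.ncard = {r ∈ R | g r = q}.ncard := by
  obtain ⟨h, h₁, h₂, h₃⟩ := h
  have hsurj : h '' R = R := Set.eq_of_subset_of_ncard_le h₁.image_subset
    h₂.ncard_image.ge hR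
  rw [← (h₂.mono (Set.sep_subset R fun r => f r = q)).ncard_image]
  congr 1
  ext r
  constructor
  · rintro ⟨r, ⟨hr, hq⟩, rfl⟩
    exact ⟨h₁ hr, (h₃ r hr).trans hq⟩
  · rintro ⟨hr, hq⟩
    rw [← hsurj] at hr
    obtain ⟨r, hr, rfl⟩ := hr
    exact ⟨r, ⟨hr, (h₃ r hr).symm.trans hq⟩, rfl⟩

lemma exists_fin_add {m n : ℕ} {P : Fin (m + n) → Prop} :
    (∃ i, P i) ↔ (∃ i, P (Fin.castAdd n i)) ∨ ∃ i, P (Fin.natAdd m i) := by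
  constructor
  · rintro ⟨i, hi⟩
    induction i using Fin.addCases with
    | left i => exact Or.inl ⟨i, hi⟩
    | right i => exact Or.inr ⟨i, hi⟩
  · rintro (⟨i, hi⟩ | ⟨i, hi⟩) <;> exact ⟨_, hi⟩

namespace Formula

variable {L : FirstOrder.Language.{u, v}}

/-- The formula `∃ w (w ⊆ d ∧ dep(w, d) ∧ ⋀ w_i = d_j)`, where `w` is a fresh copy of `d` and
`(i, j)` ranges over `E`. It says that the `d`-rows of the team inject into themselves so that
every row and its image are related as `E` prescribes. -/
def injF {n : ℕ} (d : Fin n → Var) (E : List (Fin n × Fin n)) : Formula L :=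
  let w := varBlock (freshVar d) n
  exs (List.ofFn w) ((inclF w d).and (andEqs (E.map fun p => (w p.1, d p.2)) (depF w d)))

/-- The formula `∃ d' (d' ⊆ d ∧ d ⊆ d' ∧ x' = x ∧ d ⊥_x d' ∧ ψ)`, where `d'` is a fresh copy of
`d`, the tuple `x` consists of the entries of `d` at the positions `e`, and `ψ` is
`injF (d d') E`. The first four conjuncts say that the `dd'`-rows are all pairs of `d`-rows that
agree at the positions `e`. -/
def pairInjF {n k : ℕ} (d : Fin n → Var) (e : Fin k → Fin n)
    (E : List (Fin (n + n) × Fin (n + n))) : Formula L :=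
  let d' := varBlock (freshVar d) n
  exs (List.ofFn d') ((inclF d' d).and ((inclF d d').and
    (andEqs (zipTuples (d' ∘ e) (d ∘ e))
      ((condIndep (d ∘ e) d d').and (injF (Fin.append d d') E)))))

lemma inLogic_injF {n : ℕ} (d : Fin n → Var) (E : List (Fin n × Fin n)) :
    (injF d E : Formula L).InLogic {AtomKind.condIndep} := by
  simp [injF, InLogic, inLogic_inclF, inLogic_depF]

lemma inLogic_pairInjF {n k : ℕ} (d : Fin n → Var) (e : Fin k → Fin n)
    (E : List (Fin (n + n) × Fin (n + n))) :
    (pairInjF d e E : Formula L).InLogic {AtomKind.condIndep} := by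
  simp [pairInjF, InLogic, inLogic_inclF, inLogic_injF]

lemma freeVars_injF {n : ℕ} (d : Fin n → Var) (E : List (Fin n × Fin n)) :
    (injF d E : Formula L).freeVars ⊆ tupleVars d := by
  intro v
  simp only [injF, mem_freeVars_exs, freeVars, mem_freeVars_andEqs, freeVars_depF,
    Finset.mem_union, List.mem_ofFn, mem_tupleVars]
  have h := @freeVars_inclF L _ (varBlock (freshVar d) n) d v
  simp only [Finset.mem_union, mem_tupleVars] at h
  simp only [List.mem_map]
  grind

lemma freeVars_pairInjF {n k : ℕ} (d : Fin n → Var) (e : Fin k → Fin n)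
    (E : List (Fin (n + n) × Fin (n + n))) :
    (pairInjF d e E : Formula L).freeVars ⊆ tupleVars d := by
  intro v
  simp only [pairInjF, mem_freeVars_exs, freeVars, mem_freeVars_andEqs,
    Finset.mem_union, List.mem_ofFn, mem_tupleVars, zipTuples]
  have h₁ := @freeVars_inclF L _ (varBlock (freshVar d) n) d v
  have h₂ := @freeVars_inclF L _ d (varBlock (freshVar d) n) v
  have h₃ := @freeVars_injF L _ (Fin.append d (varBlock (freshVar d) n)) E v
  simp only [Finset.mem_union, mem_tupleVars, exists_fin_add, Fin.append_left,
    Fin.append_right] at h₁ h₂ h₃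
  simp only [Function.comp_apply]
  grind

end Formula

section TotalSat

open Formula

variable {L : FirstOrder.Language.{u, v}} {A : Type w} [L.Structure A]

/-- The values of `w` in the team are the images of those of `d`. Lax semantics may offer several
images for one row; any choice among them is injective because `w` determines `d`. -/
lemma totalSat_injF {n : ℕ} (d : Fin n → Var) (E : List (Fin n × Fin n)) (T : Set (Var → A)) :
    TotalSat A (injF d E : Formula L) T ↔
      HasInjection ((fun t => t ∘ d) '' T) fun ρ σ => ∀ p ∈ E, σ p.1 = ρ p.2 := by
  set w := varBlock (freshVar d) n
  change TotalSat A (exs (List.ofFn w) (and (inclF w d) (andEqs _ (depF w d)))) T ↔ _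
  simp only [totalSat_exs, TotalSat, totalSat_inclF, totalSat_andEqs, totalSat_depF,
    List.forall_mem_map]
  constructor
  · rintro ⟨T', ⟨h₁, h₂⟩, hincl, heq, hdep⟩
    have hT' : ∀ t ∈ T', t ∘ d ∈ (fun t => t ∘ d) '' T := fun t ht => by
      obtain ⟨s, hs, hst⟩ := h₁ t ht
      exact ⟨s, hs, (comp_eq_of_eqOn_varBlock (lt_freshVar d) hst).symm⟩
    have key : ∀ ρ : (fun t => t ∘ d) '' T, ∃ t ∈ T', t ∘ d = ρ := by
      rintro ⟨_, s, hs, rfl⟩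
      obtain ⟨t, ht, hst⟩ := h₂ s hs
      exact ⟨t, ht, comp_eq_of_eqOn_varBlock (lt_freshVar d) hst⟩
    choose t ht htd using key
    classical
    refine ⟨fun ρ => if hρ : ρ ∈ (fun t => t ∘ d) '' T then t ⟨ρ, hρ⟩ ∘ w else ρ,
      fun ρ hρ => ?_, fun ρ hρ σ hσ hρσ => ?_, fun ρ hρ p hp => ?_⟩
    · obtain ⟨t', ht', h'⟩ := hincl _ (ht ⟨ρ, hρ⟩)
      simp only [dif_pos hρ, h']
      exact hT' t' ht'
    · simp only [dif_pos hρ, dif_pos hσ] at hρσ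
      exact (htd ⟨ρ, hρ⟩).symm.trans ((hdep _ (ht _) _ (ht _) hρσ).trans (htd ⟨σ, hσ⟩))
    · simp only [dif_pos hρ]
      exact (heq _ (ht _) p hp).trans (congrFun (htd ⟨ρ, hρ⟩) p.2)
  · rintro ⟨h, h₁, h₂, h₃⟩
    refine ⟨{t | (∃ s ∈ T, ∀ v ∉ List.ofFn w, t v = s v) ∧ t ∘ w = h (t ∘ d)},
      ⟨fun t ht => ht.1, fun s hs => ?_⟩, ?_, ?_, ?_⟩
    · obtain ⟨t, hst, htw⟩ := exists_eqOn_varBlock (freshVar d) s (h (s ∘ d))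
      exact ⟨t, ⟨⟨s, hs, hst⟩, by rw [htw, comp_eq_of_eqOn_varBlock (lt_freshVar d) hst]⟩, hst⟩
    · rintro t ⟨⟨s, hs, hst⟩, htw⟩
      have htd : t ∘ d = s ∘ d := comp_eq_of_eqOn_varBlock (lt_freshVar d) hst
      obtain ⟨s', hs', h'⟩ := h₁ (Set.mem_image_of_mem (fun t => t ∘ d) hs)
      obtain ⟨t', hst', htw'⟩ := exists_eqOn_varBlock (freshVar d) s' (h (s' ∘ d))
      have htd' : t' ∘ d = s' ∘ d := comp_eq_of_eqOn_varBlock (lt_freshVar d) hst'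
      exact ⟨t', ⟨⟨s', hs', hst'⟩, by rw [htw', htd']⟩, by rw [htw, htd, htd']; exact h'.symm⟩
    · rintro t ⟨⟨s, hs, hst⟩, htw⟩ p hp
      have htd : t ∘ d = s ∘ d := comp_eq_of_eqOn_varBlock (lt_freshVar d) hst
      have := h₃ _ (Set.mem_image_of_mem (fun t => t ∘ d) hs) p hp
      exact (congrFun htw p.1).trans (by rw [htd]; exact this.trans (congrFun htd p.2).symm)
    · rintro t ⟨⟨s, hs, hst⟩, htw⟩ t' ⟨⟨s', hs', hst'⟩, htw'⟩ htt
      have htd : t ∘ d = s ∘ d := comp_eq_of_eqOn_varBlock (lt_freshVar d) hst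
      have htd' : t' ∘ d = s' ∘ d := comp_eq_of_eqOn_varBlock (lt_freshVar d) hst'
      rw [htw, htw', htd, htd'] at htt
      rw [htd, htd']
      exact h₂ (Set.mem_image_of_mem (fun t => t ∘ d) hs)
        (Set.mem_image_of_mem (fun t => t ∘ d) hs') htt

lemma append_comp {m n : ℕ} (t : Var → A) (x : Fin m → Var) (y : Fin n → Var) :
    t ∘ Fin.append x y = Fin.append (t ∘ x) (t ∘ y) := by
  funext i
  refine Fin.addCases (fun i => ?_) (fun i => ?_) i <;> simp

/-- In the reassigned team every `d`-row occurs as a value of `d'` too, and independence of `d` and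
`d'` given `x` combines any two rows that agree on `x`. -/
lemma totalSat_pairInjF {n k : ℕ} (d : Fin n → Var) (e : Fin k → Fin n)
    (E : List (Fin (n + n) × Fin (n + n))) (T : Set (Var → A)) :
    TotalSat A (pairInjF d e E : Formula L) T ↔
      HasInjection {ρ | ∃ s ∈ T, ∃ s' ∈ T, s ∘ d ∘ e = s' ∘ d ∘ e ∧
        Fin.append (s ∘ d) (s' ∘ d) = ρ} fun ρ σ => ∀ p ∈ E, σ p.1 = ρ p.2 := by
  set d' := varBlock (freshVar d) n
  change TotalSat A (exs (List.ofFn d') (and (inclF d' d) (and (inclF d d')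
    (andEqs (zipTuples (d' ∘ e) (d ∘ e)) (and (condIndep (d ∘ e) d d')
      (injF (Fin.append d d') E)))))) T ↔ _
  have hd : ∀ {s t : Var → A}, (∀ v ∉ List.ofFn d', t v = s v) → t ∘ d = s ∘ d :=
    fun h => comp_eq_of_eqOn_varBlock (lt_freshVar d) h
  simp only [totalSat_exs, TotalSat, totalSat_inclF, totalSat_andEqs, totalSat_injF,
    forall_mem_zipTuples, append_comp]
  constructor
  · rintro ⟨T', ⟨h₁, h₂⟩, hincl, hincl', heq, hind, hinj⟩
    convert hinj using 1
    ext ρ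
    constructor
    · rintro ⟨s, hs, s', hs', hss, rfl⟩
      obtain ⟨t, ht, hst⟩ := h₂ s hs
      obtain ⟨t', ht', hst'⟩ := h₂ s' hs'
      obtain ⟨u', hu', htu⟩ := hincl' t' ht'
      have hx : t ∘ d ∘ e = u' ∘ d ∘ e := by
        have h : u' ∘ d' ∘ e = u' ∘ d ∘ e := heq u' hu'
        rw [← h, ← Function.comp_assoc u', ← htu, hd hst', ← Function.comp_assoc, hd hst]
        exact hss
      obtain ⟨u, hu, -, hud, hud'⟩ := hind t ht u' hu' hx
      exact ⟨u, hu, by simp only [hud, hud', hd hst, ← htu, hd hst']⟩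
    · rintro ⟨t, ht, rfl⟩
      obtain ⟨s, hs, hst⟩ := h₁ t ht
      obtain ⟨t', ht', htt⟩ := hincl t ht
      obtain ⟨s', hs', hst'⟩ := h₁ t' ht'
      have htd' : t ∘ d' = s' ∘ d := htt.trans (hd hst')
      refine ⟨s, hs, s', hs', ?_, by simp only [htd', hd hst]⟩
      rw [← Function.comp_assoc, ← Function.comp_assoc, ← htd', ← hd hst]
      exact (heq t ht).symm
  · intro hinj
    have key : ∀ s ∈ T, ∀ s' ∈ T, s ∘ d ∘ e = s' ∘ d ∘ e → ∃ t,
        (∀ v ∉ List.ofFn d', t v = s v) ∧ t ∘ d = s ∘ d ∧ t ∘ d' = s' ∘ d ∧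
          t ∈ {t | ∃ s ∈ T, ∃ s' ∈ T, s ∘ d ∘ e = s' ∘ d ∘ e ∧
            (∀ v ∉ List.ofFn d', t v = s v) ∧ t ∘ d' = s' ∘ d} := by
      intro s hs s' hs' h
      obtain ⟨t, hst, ht⟩ := exists_eqOn_varBlock (freshVar d) s (s' ∘ d)
      exact ⟨t, hst, hd hst, ht, s, hs, s', hs', h, hst, ht⟩
    refine ⟨{t | ∃ s ∈ T, ∃ s' ∈ T, s ∘ d ∘ e = s' ∘ d ∘ e ∧
      (∀ v ∉ List.ofFn d', t v = s v) ∧ t ∘ d' = s' ∘ d}, ⟨?_, ?_⟩, ?_, ?_, ?_, ?_, ?_⟩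
    · rintro t ⟨s, hs, -, -, -, hst, -⟩
      exact ⟨s, hs, hst⟩
    · intro s hs
      obtain ⟨t, hst, -, -, ht⟩ := key s hs s hs rfl
      exact ⟨t, ht, hst⟩
    · rintro t ⟨s, hs, s', hs', h, hst, ht⟩
      obtain ⟨t', -, ht', -, hmem⟩ := key s' hs' s' hs' rfl
      exact ⟨t', hmem, ht.trans ht'.symm⟩
    · rintro t ⟨s, hs, s', hs', h, hst, ht⟩
      obtain ⟨t', -, -, ht', hmem⟩ := key s hs s hs rfl
      exact ⟨t', hmem, (hd hst).trans ht'.symm⟩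
    · rintro t ⟨s, hs, s', hs', h, hst, ht⟩
      rw [← Function.comp_assoc, ← Function.comp_assoc, ht, hd hst]
      exact h.symm
    · rintro t ⟨s, hs, s', hs', h, hst, ht⟩ u ⟨r, hr, r', hr', hrr, hru, hu⟩ htu
      rw [← Function.comp_assoc, ← Function.comp_assoc, hd hst, hd hru] at htu
      obtain ⟨t', -, ht', ht'', hmem⟩ := key s hs r' hr' (htu.trans hrr)
      refine ⟨t', hmem, ?_, ht'.trans (hd hst).symm, ht''.trans hu.symm⟩
      rw [← Function.comp_assoc, ← Function.comp_assoc, ht', hd hst]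
    · convert hinj using 1
      ext ρ
      constructor
      · rintro ⟨t, ⟨s, hs, s', hs', h, hst, ht⟩, rfl⟩
        exact ⟨s, hs, s', hs', h, by simp only [hd hst, ht]⟩
      · rintro ⟨s, hs, s', hs', h, rfl⟩
        obtain ⟨t, -, ht, ht', hmem⟩ := key s hs s' hs' h
        exact ⟨t, hmem, by simp only [ht, ht']⟩

end TotalSat

/-! ### The probabilistic atoms as injectivity statements -/

section Counting

variable {D : Finset Var} {A : Type w}

lemma size_select_toMultiteam [Finite A] (X : Team D A) {k : ℕ} (x : Fin k → D) (a : Fin k → A) :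
    (X.toMultiteam.select x a).size = {s ∈ X | s.tuple x = a}.ncard := by
  classical
  have : Fintype X := Fintype.ofFinite X
  change ∑ᶠ s : X, (if Assignment.tuple s.1 x = a then 1 else 0) = _
  rw [finsum_eq_sum_of_fintype, Finset.sum_boole, Nat.cast_id, ← Set.ncard_coe_finset,
    ← Set.ncard_image_of_injective _ Subtype.val_injective]
  congr 1
  ext s
  simp [and_comm]

lemma tuple_append_eq_iff {k l : ℕ} (s t : Assignment D A) (x : Fin k → D) (y : Fin l → D) :
    s.tuple (Fin.append x y) = t.tuple (Fin.append x y) ↔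
      s.tuple x = t.tuple x ∧ s.tuple y = t.tuple y := by
  simp [funext_iff, Assignment.tuple, Fin.forall_fin_add]

/-- The atom `x ≤ y` compares the fibres of `s ↦ s(x)` and `s ↦ s(y)`. -/
lemma probIncl_iff_hasInjection [Finite A] (X : Team D A) {k : ℕ} (x y : Fin k → D) :
    X.toMultiteam.ProbIncl x y ↔ HasInjection X fun s t => t.tuple y = s.tuple x := by
  simp only [Multiteam.ProbIncl, size_select_toMultiteam]
  constructor
  · intro h
    exact hasInjection_of_ncard_le (Set.toFinite X) (f := fun s => s.tuple x)
      (g := fun s => s.tuple y) fun s _ => h s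
  · intro h s
    exact (HasInjection.ncard_eq (Set.toFinite X) (f := fun s : Assignment D A => s.tuple x)
      (g := fun s => s.tuple y) h _).le

/-- On the set of pairs of assignments that agree on `x`, the atom `y ⊥⊥_x z` compares the fibres
of `(t, t') ↦ t(xyz)` with those of `(s, s') ↦ (s(xy), s'(z))`. -/
lemma probCondIndep_iff_hasInjection [Finite A] (X : Team D A) {k l n : ℕ}
    (x : Fin k → D) (y : Fin l → D) (z : Fin n → D) :
    X.toMultiteam.ProbCondIndep x y z ↔
      HasInjection {p : Assignment D A × Assignment D A |
          p.1 ∈ X ∧ p.2 ∈ X ∧ p.1.tuple x = p.2.tuple x} fun p q =>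
        (q.1.tuple x, q.1.tuple y, q.2.tuple z) = (p.1.tuple x, p.1.tuple y, p.1.tuple z) := by
  set P := {p : Assignment D A × Assignment D A |
    p.1 ∈ X ∧ p.2 ∈ X ∧ p.1.tuple x = p.2.tuple x}
  simp only [Multiteam.ProbCondIndep, size_select_toMultiteam, tuple_append_eq_iff,
    ← Set.ncard_prod]
  have hg : ∀ s : Assignment D A,
      {r ∈ X | r.tuple x = s.tuple x ∧ r.tuple y = s.tuple y} ×ˢ
        {r ∈ X | r.tuple x = s.tuple x ∧ r.tuple z = s.tuple z} =
      {q ∈ P | (q.1.tuple x, q.1.tuple y, q.2.tuple z) =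
        (s.tuple x, s.tuple y, s.tuple z)} := by
    intro s
    ext ⟨q, q'⟩
    simp only [P, Set.mem_prod, Set.mem_ofPred_eq, Prod.mk.injEq]
    grind
  have hf : ∀ s : Assignment D A,
      {r ∈ X | (r.tuple x = s.tuple x ∧ r.tuple y = s.tuple y) ∧ r.tuple z = s.tuple z} ×ˢ
        {r ∈ X | r.tuple x = s.tuple x} =
      {p ∈ P | (p.1.tuple x, p.1.tuple y, p.1.tuple z) =
        (s.tuple x, s.tuple y, s.tuple z)} := by
    intro s
    ext ⟨p, p'⟩
    simp only [P, Set.mem_prod, Set.mem_ofPred_eq, Prod.mk.injEq]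
    grind
  simp only [hf, hg]
  constructor
  · intro h
    -- The values of `f` are consistent where `x`, `y`, `z` share variables, so the atom
    -- says something about each of them; values of `g` need not be.
    exact hasInjection_of_ncard_le (Set.toFinite P)
      (f := fun p => (p.1.tuple x, p.1.tuple y, p.1.tuple z))
      (g := fun q => (q.1.tuple x, q.1.tuple y, q.2.tuple z)) fun p _ => (h p.1).ge
  · intro h s
    exact (HasInjection.ncard_eq (Set.toFinite P)
      (f := fun p : Assignment D A × Assignment D A => (p.1.tuple x, p.1.tuple y, p.1.tuple z))
      (g := fun q => (q.1.tuple x, q.1.tuple y, q.2.tuple z)) h _).symm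

end Counting

/-! ### The translation -/

/-- An enumeration of the finite domain `D`. -/
noncomputable def domTuple (D : Finset Var) : Fin D.card → Var := fun i => D.equivFin.symm i

/-- Assignments with domain `D` as tuples of values. -/
noncomputable def assignmentEquiv (D : Finset Var) (A : Type w) :
    Assignment D A ≃ (Fin D.card → A) :=
  D.equivFin.arrowCongr (Equiv.refl A)

/-- The positions in `domTuple D` of the entries of a tuple of variables from `D`. -/
noncomputable def positions {D : Finset Var} {k : ℕ} (x : Fin k → D) : Fin k → Fin D.card :=
  D.equivFin ∘ x

lemma tupleVars_domTuple (D : Finset Var) : tupleVars (domTuple D) = D := by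
  ext v
  rw [Formula.mem_tupleVars]
  constructor
  · rintro ⟨i, rfl⟩
    exact (D.equivFin.symm i).2
  · intro hv
    exact ⟨D.equivFin ⟨v, hv⟩, by simp [domTuple]⟩

lemma restrictTo_comp_domTuple {D : Finset Var} {A : Type w} (t : Var → A) :
    t ∘ domTuple D = assignmentEquiv D A (restrictTo D t) := rfl

lemma assignmentEquiv_positions {D : Finset Var} {A : Type w} (s : Assignment D A) {k : ℕ}
    (x : Fin k → D) (i : Fin k) : assignmentEquiv D A s (positions x i) = s (x i) := by
  simp [assignmentEquiv, positions]

lemma assignmentEquiv_comp_positions {D : Finset Var} {A : Type w} (s : Assignment D A) {k : ℕ}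
    (x : Fin k → D) : assignmentEquiv D A s ∘ positions x = s.tuple x :=
  funext fun i => assignmentEquiv_positions s x i

section Translation

open Formula

variable {L : FirstOrder.Language.{u, v}}

/-- The atom `x ≤ y`, read in teams with domain `D`, in independence logic. -/
noncomputable def probInclF {D : Finset Var} {k : ℕ} (x y : Fin k → D) : Formula L :=
  injF (domTuple D) (List.ofFn fun i => (positions y i, positions x i))

/-- The atom `y ⊥⊥_x z`, read in teams with domain `D`, in independence logic. The list of
positions says that a pair `(t, t')` is mapped to a pair `(s, s')` with `s(x) = t(x)`,
`s(y) = t(y)` and `s'(z) = t(z)`. -/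
noncomputable def probCondIndepF {D : Finset Var} {k l n : ℕ} (x : Fin k → D) (y : Fin l → D)
    (z : Fin n → D) : Formula L :=
  pairInjF (domTuple D) (positions x)
    ((List.ofFn fun i => (Fin.castAdd _ (positions x i), Fin.castAdd _ (positions x i))) ++
      (List.ofFn fun i => (Fin.castAdd _ (positions y i), Fin.castAdd _ (positions y i))) ++
      List.ofFn fun i => (Fin.natAdd _ (positions z i), Fin.castAdd _ (positions z i)))

lemma freeVars_probInclF {D : Finset Var} {k : ℕ} (x y : Fin k → D) :
    (probInclF x y : Formula L).freeVars ⊆ D :=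
  (freeVars_injF _ _).trans (tupleVars_domTuple D).subset

lemma freeVars_probCondIndepF {D : Finset Var} {k l n : ℕ} (x : Fin k → D) (y : Fin l → D)
    (z : Fin n → D) : (probCondIndepF x y z : Formula L).freeVars ⊆ D :=
  (freeVars_pairInjF _ _ _).trans (tupleVars_domTuple D).subset

variable {A : Type w} [L.Structure A]

lemma restrictTo_surjective [Nonempty A] (D : Finset Var) :
    Function.Surjective (restrictTo D : (Var → A) → Assignment D A) := by
  classical
  intro s
  exact ⟨fun v => if h : v ∈ D then s ⟨v, h⟩ else Classical.arbitrary A, by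
    funext v; simp [restrictTo]⟩

lemma sat_iff_totalSat_preimage [Nonempty A] (φ : Formula L)
    (hφ : φ.InLogic {AtomKind.condIndep}) (D : Finset Var) (h : φ.freeVars ⊆ D) (X : Team D A) :
    Sat A φ D h X ↔ TotalSat A φ (restrictTo D ⁻¹' X) := by
  rw [← sat_iff_totalSat φ hφ D h, Set.image_preimage_eq _ (restrictTo_surjective D)]

lemma totalSat_probInclF [Finite A] [Nonempty A] {D : Finset Var} {k : ℕ} (x y : Fin k → D)
    (X : Team D A) :
    TotalSat A (probInclF x y : Formula L) (restrictTo D ⁻¹' X) ↔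
      X.toMultiteam.ProbIncl x y := by
  have himg : (fun t : Var → A => t ∘ domTuple D) '' (restrictTo D ⁻¹' X) =
      assignmentEquiv D A '' X := by
    simp only [restrictTo_comp_domTuple]
    rw [← Set.image_image (assignmentEquiv D A) (restrictTo D),
      Set.image_preimage_eq _ (restrictTo_surjective D)]
  rw [probInclF, totalSat_injF, himg, hasInjection_image, probIncl_iff_hasInjection]
  simp only [List.forall_mem_ofFn_iff, assignmentEquiv_positions, funext_iff, Assignment.tuple]

lemma totalSat_probCondIndepF [Finite A] [Nonempty A] {D : Finset Var} {k l n : ℕ}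
    (x : Fin k → D) (y : Fin l → D) (z : Fin n → D) (X : Team D A) :
    TotalSat A (probCondIndepF x y z : Formula L) (restrictTo D ⁻¹' X) ↔
      X.toMultiteam.ProbCondIndep x y z := by
  set Φ : Assignment D A × Assignment D A ≃ (Fin (D.card + D.card) → A) :=
    ((assignmentEquiv D A).prodCongr (assignmentEquiv D A)).trans (Fin.appendEquiv _ _)
  have hΦ : ∀ p, Φ p = Fin.append (assignmentEquiv D A p.1) (assignmentEquiv D A p.2) :=
    fun _ => rfl
  have himg : {ρ | ∃ s ∈ restrictTo D ⁻¹' X, ∃ s' ∈ restrictTo D ⁻¹' X,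
        s ∘ domTuple D ∘ positions x = s' ∘ domTuple D ∘ positions x ∧
        Fin.append (s ∘ domTuple D) (s' ∘ domTuple D) = ρ} =
      Φ '' {p | p.1 ∈ X ∧ p.2 ∈ X ∧ p.1.tuple x = p.2.tuple x} := by
    ext ρ
    simp only [← Function.comp_assoc, restrictTo_comp_domTuple, assignmentEquiv_comp_positions]
    constructor
    · rintro ⟨s, hs, s', hs', h, rfl⟩
      exact ⟨(restrictTo D s, restrictTo D s'), ⟨hs, hs', h⟩, rfl⟩
    · rintro ⟨⟨s, s'⟩, ⟨hs, hs', h⟩, rfl⟩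
      obtain ⟨s, rfl⟩ := restrictTo_surjective D s
      obtain ⟨s', rfl⟩ := restrictTo_surjective D s'
      exact ⟨s, hs, s', hs', h, rfl⟩
  rw [probCondIndepF, totalSat_pairInjF, himg, hasInjection_image, probCondIndep_iff_hasInjection]
  simp only [List.forall_mem_append, List.forall_mem_ofFn_iff, hΦ, Fin.append_left,
    Fin.append_right, assignmentEquiv_positions, Prod.mk.injEq, funext_iff, Assignment.tuple,
    and_assoc]

end Translation

/-- On teams with a given domain, every formula is equivalent to one of independence logic. The
domain has to be fixed because the probabilistic atoms count whole assignments, so that their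
translations quantify over copies of all variables in the domain. -/
theorem exists_equivalent_condIndep {L : FirstOrder.Language.{u, v}} (φ : Formula L)
    (D : Finset Var) (h : φ.freeVars ⊆ D) :
    ∃ φ' : Formula L, φ'.InLogic {AtomKind.condIndep} ∧ ∃ h' : φ'.freeVars ⊆ D,
      ∀ (A : Type w) [L.Structure A] [Finite A] [Nonempty A] (X : Team D A),
        Sat A φ D h X ↔ Sat A φ' D h' X := by
  induction φ generalizing D with
  | eq x y => exact ⟨.eq x y, trivial, h, fun _ => by intros; rfl⟩
  | ne x y => exact ⟨.ne x y, trivial, h, fun _ => by intros; rfl⟩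
  | rel R x => exact ⟨.rel R x, trivial, h, fun _ => by intros; rfl⟩
  | nrel R x => exact ⟨.nrel R x, trivial, h, fun _ => by intros; rfl⟩
  | condIndep x y z => exact ⟨.condIndep x y z, rfl, h, fun _ => by intros; rfl⟩
  | probIncl x y =>
    refine ⟨probInclF (tupleIn x (Finset.union_subset_left h))
      (tupleIn y (Finset.union_subset_right h)), Formula.inLogic_injF _ _,
      freeVars_probInclF _ _, fun A _ _ _ X => ?_⟩
    exact ((sat_iff_totalSat_preimage _ (Formula.inLogic_injF _ _) D _ X).trans
      (totalSat_probInclF _ _ X)).symm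
  | probCondIndep x y z =>
    refine ⟨probCondIndepF (tupleIn x (Finset.union_subset_left (Finset.union_subset_left h)))
      (tupleIn y (Finset.union_subset_right (Finset.union_subset_left h)))
      (tupleIn z (Finset.union_subset_right h)), Formula.inLogic_pairInjF _ _ _,
      freeVars_probCondIndepF _ _ _, fun A _ _ _ X => ?_⟩
    exact ((sat_iff_totalSat_preimage _ (Formula.inLogic_pairInjF _ _ _) D _ X).trans
      (totalSat_probCondIndepF _ _ _ X)).symm
  | dep x y =>
    refine ⟨Formula.depF x y, Formula.inLogic_depF x y, (Formula.freeVars_depF x y).subset.trans h,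
      fun A _ _ _ X => ?_⟩
    rw [sat_iff_totalSat_preimage _ (Formula.inLogic_depF x y), totalSat_depF]
    exact (restrictTo_surjective D).forall.trans (forall₂_congr fun s _ =>
      (restrictTo_surjective D).forall)
  | incl x y =>
    refine ⟨Formula.inclF x y, Formula.inLogic_inclF x y, (Formula.freeVars_inclF x y).trans h,
      fun A _ _ _ X => ?_⟩
    rw [sat_iff_totalSat_preimage _ (Formula.inLogic_inclF x y), totalSat_inclF]
    exact (restrictTo_surjective D).forall.trans (forall₂_congr fun s _ =>
      (restrictTo_surjective D).exists)
  | and φ ψ ih₁ ih₂ =>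
    obtain ⟨φ', h₁, h₁', hφ⟩ := ih₁ D (Finset.union_subset_left h)
    obtain ⟨ψ', h₂, h₂', hψ⟩ := ih₂ D (Finset.union_subset_right h)
    exact ⟨φ'.and ψ', ⟨h₁, h₂⟩, Finset.union_subset h₁' h₂', fun A _ _ _ X =>
      and_congr (hφ A X) (hψ A X)⟩
  | or φ ψ ih₁ ih₂ =>
    obtain ⟨φ', h₁, h₁', hφ⟩ := ih₁ D (Finset.union_subset_left h)
    obtain ⟨ψ', h₂, h₂', hψ⟩ := ih₂ D (Finset.union_subset_right h)
    refine ⟨φ'.or ψ', ⟨h₁, h₂⟩, Finset.union_subset h₁' h₂', fun A _ _ _ X => ?_⟩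
    simp only [Sat, hφ, hψ]
  | ex x φ ih =>
    obtain ⟨φ', h₁, h', hφ⟩ := ih (insert x D) (Finset.subset_insert_iff.mpr h)
    exact ⟨φ'.ex x, h₁, Finset.subset_insert_iff.mp h', fun A _ _ _ X =>
      exists_congr fun F => hφ A _⟩
  | all x φ ih =>
    obtain ⟨φ', h₁, h', hφ⟩ := ih (insert x D) (Finset.subset_insert_iff.mpr h)
    exact ⟨φ'.all x, h₁, Finset.subset_insert_iff.mp h', fun A _ _ _ X => hφ A _⟩

end TeamSemantics

theorem mainTheorem3 (L : FirstOrder.Language.{u, v}) [L.IsRelational]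
    (φ : TeamSemantics.Sentence L
      {TeamSemantics.AtomKind.probIncl, TeamSemantics.AtomKind.probCondIndep,
        TeamSemantics.AtomKind.dep, TeamSemantics.AtomKind.incl,
        TeamSemantics.AtomKind.condIndep}) :
    ∃ φ' : TeamSemantics.Sentence L {TeamSemantics.AtomKind.condIndep},
      ∀ (A : Type w) [L.Structure A] [Finite A] [Nonempty A],
        TeamSemantics.Models A φ ↔ TeamSemantics.Models A φ' := by
  obtain ⟨φ', h₁, h₂, h⟩ := TeamSemantics.exists_equivalent_condIndep.{u, v, w} φ.formula ∅
    φ.freeVars_eq.subset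
  exact ⟨⟨φ', h₁, Finset.subset_empty.1 h₂⟩, fun A _ _ _ => h A _⟩
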